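/- Let $M$ be a finite-dimensional smooth Riemannian manifold with distance $d$ that is uniquely geodesic: any two points are joined by exactly one geodesic (parametrized on $[0,1]$, up to its values there), and this geodesic realizes their distance. Let $\mathrm{Exp}$ be the (possibly only partially defined) exponential map and $\mathrm{Exp}_x^{-1}(y)$ the initial velocity of the geodesic from $x$ to $y$, and write $D_u(v,w)=\|\mathrm{Exp}_u^{-1}(v)-\mathrm{Exp}_u^{-1}(w)\|_u$. Let $L>0$, $\mu>0$, and let $f:M\to\mathbb R$ be differentiable, geodesically $L$-smooth and geodesically $\mu$-strongly convex, i.e. for all $x,y\in M$ $$\tfrac{\mu}{2}d(x,y)^2\le f(y)-f(x)-\langle\nabla f(x),\mathrm{Exp}_x^{-1}(y)\rangle_x\le\tfrac L2 d(x,y)^2 ,$$ with a global minimizer $x_*$. Let $\gamma\in(0,2/L)$, $\Delta_\gamma=\gamma(1-L\gamma/2)$, and $\delta\ge1$. Let $x_t,y_t,z_t\in M$ and $\xi_t\in\mathbb R$ ($t\ge0$) be sequences such that, for all $t\ge 0$, $\xi_{t+1}\in[2\mu\Delta_\gamma,1)$, $$\frac{\xi_{t+1}(\xi_{t+1}-2\mu\Delta_\gamma)}{1-\xi_{t+1}}=\frac{\xi_t^2}{\delta},$$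 and, with $\alpha_{t+1}=\frac{\xi_{t+1}-2\mu\Delta_\gamma}{1-2\mu\Delta_\gamma}$, $\beta_{t+1}=1-\frac{2\mu\Delta_\gamma}{\xi_{t+1}}$, $\eta_{t+1}=\frac{2\Delta_\gamma}{\xi_{t+1}}$, $$x_{t+1}=\mathrm{Exp}_{y_t}\bigl(\alpha_{t+1}\mathrm{Exp}_{y_t}^{-1}(z_t)\bigr),\qquad y_{t+1}=\mathrm{Exp}_{x_{t+1}}\bigl(-\gamma\nabla f(x_{t+1})\bigr),$$ $$z_{t+1}=\mathrm{Exp}_{x_{t+1}}\bigl(\beta_{t+1}\mathrm{Exp}_{x_{t+1}}^{-1}(z_t)-\eta_{t+1}\nabla f(x_{t+1})\bigr).$$ Assume that the constant $\delta$ is a valid distortion rate at every iteration: $D_{x_t}(z_{t-1},x_*)^2\le\delta\, D_{x_{t-1}}(z_{t-1},x_*)^2$ for all $t\ge1$. For $\delta'\ge1$ set $$\xi(\delta')=\tfrac12\Bigl(\sqrt{(\delta'-1)^2+8\delta'\mu\Delta_\gamma}-(\delta'-1)\Bigr).$$ If $\xi_0\ge\xi(\delta)$, then, as $t\to\infty$,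 $$f(y_t)-f(x_*)=O\Bigl(\prod_{i=1}^t(1-\xi(\delta))\Bigr)\quad\text{and}\quad f(y_t)-f(x_*)=O\bigl(\exp(-t\,\xi(\delta))\bigr);$$ more precisely, for all $t\ge0$, $$f(y_t)-f(x_*)\le\prod_{i=1}^t(1-\xi(\delta))\cdot\Bigl[f(y_0)-f(x_*)+\tfrac{\xi_0^2}{4\Delta_\gamma}D_{x_0}(z_0,x_*)^2\Bigr].$$ In particular, if $\gamma=1/L$, then $f(y_t)-f(x_*)=O\Bigl(\exp\bigl(-\tfrac t2\bigl\{\sqrt{(\delta-1)^2+4\delta\mu/L}-(\delta-1)\bigr\}\bigr)\Bigr)$. Moreover, $\delta'\mapsto\xi(\delta')$ is strictly decreasing on $[1,\infty)$, $\xi(1)=\sqrt{2\mu\Delta_\gamma}$, $\xi(\delta')>2\mu\Delta_\gamma$ for all $\delta'\ge1$, and $\lim_{\delta'\to\infty}\xi(\delta')=2\mu\Delta_\gamma$; so the rate $\xi(\delta)$ always strictly exceeds the gradient descent rate $2\mu\Delta_\gamma$. -/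

import Mathlib

open Bundle Set Filter Topology Asymptotics
open scoped Manifold ContDiff

noncomputable section RiemannianAcceleration

variable (E : Type*) [NormedAddCommGroup E] [NormedSpace ℝ E]
  {M : Type*} [MetricSpace M] [ChartedSpace E M]
  [RiemannianBundle (fun x : M => TangentSpace 𝓘(ℝ, E) x)]

/-- The Riemannian metric read in the chart around `x₀`: the inner product, in the tangent space at
the point with coordinates `p`, of the tangent vectors with coordinates `v` and `w`. -/
def metricInChart (x₀ : M) (p v w : E) : ℝ :=
  inner ℝ
    (mfderiv 𝓘(ℝ, E) 𝓘(ℝ, E) (extChartAt 𝓘(ℝ, E) x₀).symm p v :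
      TangentSpace 𝓘(ℝ, E) ((extChartAt 𝓘(ℝ, E) x₀).symm p))
    (mfderiv 𝓘(ℝ, E) 𝓘(ℝ, E) (extChartAt 𝓘(ℝ, E) x₀).symm p w)

/-- `g` is a geodesic at the times in the open set `J`: in every chart, with coordinate curve `u`
and metric `G`, it satisfies the geodesic equation
`d/dt (G_u(u', w)) = (1/2) ∂_w G_u(u', u')` for every constant vector `w`, that is, the
Euler-Lagrange equation of the energy `(1/2) ∫ G_u(u', u')`. -/
structure IsGeodesicOn (g : ℝ → M) (J : Set ℝ) : Prop where
  continuousAt : ∀ t ∈ J, ContinuousAt g t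
  differentiableAt : ∀ t ∈ J, ∀ x₀ : M, g t ∈ (chartAt E x₀).source →
    DifferentiableAt ℝ (fun s => extChartAt 𝓘(ℝ, E) x₀ (g s)) t
  geodesicEquation : ∀ t ∈ J, ∀ x₀ : M, g t ∈ (chartAt E x₀).source → ∀ w : E,
    HasDerivAt
      (fun s => metricInChart E x₀ (extChartAt 𝓘(ℝ, E) x₀ (g s))
        (deriv (fun r => extChartAt 𝓘(ℝ, E) x₀ (g r)) s) w)
      ((1 / 2) * fderiv ℝ
        (fun p => metricInChart E x₀ p
          (deriv (fun r => extChartAt 𝓘(ℝ, E) x₀ (g r)) t)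
          (deriv (fun r => extChartAt 𝓘(ℝ, E) x₀ (g r)) t))
        (extChartAt 𝓘(ℝ, E) x₀ (g t)) w) t

/-- `g`, restricted to `[0, 1]`, is a geodesic from `x` to `y`. -/
structure IsGeodesicSegment (g : ℝ → M) (x y : M) : Prop where
  isGeodesicOn : ∃ ε > 0, IsGeodesicOn E g (Ioo (-ε) (1 + ε))
  source : g 0 = x
  target : g 1 = y

variable (M) in
/-- `M` is uniquely geodesic: any two points are joined by a shortest geodesic, and by no other
geodesic. -/
def UniquelyGeodesic : Prop :=
  ∀ x y : M,
    (∃ g : ℝ → M, IsGeodesicSegment E g x y ∧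
      Manifold.pathELength 𝓘(ℝ, E) g 0 1 = edist x y) ∧
    ∀ g h : ℝ → M, IsGeodesicSegment E g x y → IsGeodesicSegment E h x y →
      EqOn g h (Icc 0 1)

variable {E} in
/-- `y = Exp_x(v)`, the (partially defined) exponential map being given by its graph: there is a
geodesic on `[0, 1]` that starts at `x` with velocity `v` and ends at `y`. -/
def IsExp (x : M) (v : TangentSpace 𝓘(ℝ, E) x) (y : M) : Prop :=
  ∃ g : ℝ → M, IsGeodesicSegment E g x y ∧
    (⟨g 0, mfderiv 𝓘(ℝ, ℝ) 𝓘(ℝ, E) g 0 (1 : ℝ)⟩ : TangentBundle 𝓘(ℝ, E) M) = ⟨x, v⟩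

/-- The inverse exponential map: `riemLog E x y` is the vector `v` at `x` with `y = Exp_x(v)`; it
exists and is unique on a uniquely geodesic manifold. -/
def riemLog (x y : M) : TangentSpace 𝓘(ℝ, E) x :=
  Classical.epsilon fun v : TangentSpace 𝓘(ℝ, E) x => IsExp x v y

/-- The projected distance of `v` and `w` relative to `u`. -/
def projDist (u v w : M) : ℝ := ‖riemLog E u v - riemLog E u w‖

/-- The Riemannian gradient: `⟨riemGrad E f x, v⟩ = df_x(v)` for all tangent vectors `v` at `x`. -/
def riemGrad [FiniteDimensional ℝ E] (f : M → ℝ) (x : M) : TangentSpace 𝓘(ℝ, E) x :=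
  haveI : FiniteDimensional ℝ (TangentSpace 𝓘(ℝ, E) x) := inferInstanceAs (FiniteDimensional ℝ E)
  haveI : CompleteSpace (TangentSpace 𝓘(ℝ, E) x) := FiniteDimensional.complete ℝ _
  (InnerProductSpace.toDual ℝ (TangentSpace 𝓘(ℝ, E) x)).symm
    (mfderiv 𝓘(ℝ, E) 𝓘(ℝ, ℝ) f x)

/-- Geodesic `L`-smoothness of a differentiable function. -/
def GeodesicallySmooth [FiniteDimensional ℝ E] (L : ℝ) (f : M → ℝ) : Prop :=
  MDifferentiable 𝓘(ℝ, E) 𝓘(ℝ, ℝ) f ∧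
    ∀ x y : M, f y ≤ f x + inner ℝ (riemGrad E f x) (riemLog E x y) + L / 2 * dist x y ^ 2

/-- Geodesic `μ`-strong convexity of a differentiable function. -/
def GeodesicallyStronglyConvex [FiniteDimensional ℝ E] (μ : ℝ) (f : M → ℝ) : Prop :=
  MDifferentiable 𝓘(ℝ, E) 𝓘(ℝ, ℝ) f ∧
    ∀ x y : M, f x + inner ℝ (riemGrad E f x) (riemLog E x y) + μ / 2 * dist x y ^ 2 ≤ f y

/-- `δ` is a valid distortion rate, with respect to the point `p`, at iteration `t ≥ 1` of the
sequences `x`, `z`. -/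
def IsValidDistortionRate (p : M) (x z : ℕ → M) (δ : ℝ) (t : ℕ) : Prop :=
  projDist E (x t) (z (t - 1)) p ^ 2 ≤ δ * projDist E (x (t - 1)) (z (t - 1)) p ^ 2

/-- `Δ_γ = γ (1 - L γ / 2)`. -/
def stepGain (L γ : ℝ) : ℝ := γ * (1 - L * γ / 2)

/-- `ξ(δ)`, as a function of `μ`, `Δ = Δ_γ` and `δ`. -/
def accelRate (μ Δ δ : ℝ) : ℝ := √((δ - 1) ^ 2 + 8 * δ * μ * Δ) / 2 - (δ - 1) / 2

/-- `x`, `y`, `z` and `ξ` are generated by the Riemannian analogue of Nesterov's iteration with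
constant step size `γ` and constant distortion rate `δ`, from the initial data `x 0`, `y 0`, `z 0`
and `ξ 0`. -/
structure IsRiemannianNesterov [FiniteDimensional ℝ E] (f : M → ℝ) (L μ γ δ : ℝ)
    (x y z : ℕ → M) (ξ : ℕ → ℝ) : Prop where
  /-- `ξ_{t+1}` lies in `[2 μ Δ_γ, 1)`. -/
  ξ_mem : ∀ t, ξ (t + 1) ∈ Ico (2 * μ * stepGain L γ) 1
  /-- The recursion for `ξ`. -/
  ξ_succ : ∀ t, ξ (t + 1) * (ξ (t + 1) - 2 * μ * stepGain L γ) / (1 - ξ (t + 1)) = ξ t ^ 2 / δ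
  /-- `x_{t+1} = Exp_{y_t}(α_{t+1} Exp_{y_t}⁻¹(z_t))`,
  with `α_{t+1} = (ξ_{t+1} - 2 μ Δ_γ) / (1 - 2 μ Δ_γ)`. -/
  x_succ : ∀ t, IsExp (y t)
    (((ξ (t + 1) - 2 * μ * stepGain L γ) / (1 - 2 * μ * stepGain L γ)) • riemLog E (y t) (z t))
    (x (t + 1))
  /-- `y_{t+1} = Exp_{x_{t+1}}(-γ ∇f(x_{t+1}))`. -/
  y_succ : ∀ t, IsExp (x (t + 1)) (-(γ • riemGrad E f (x (t + 1)))) (y (t + 1))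
  /-- `z_{t+1} = Exp_{x_{t+1}}(β_{t+1} Exp_{x_{t+1}}⁻¹(z_t) - η_{t+1} ∇f(x_{t+1}))`,
  with `β_{t+1} = 1 - 2 μ Δ_γ / ξ_{t+1}` and `η_{t+1} = 2 Δ_γ / ξ_{t+1}`. -/
  z_succ : ∀ t, IsExp (x (t + 1))
    ((1 - 2 * μ * stepGain L γ / ξ (t + 1)) • riemLog E (x (t + 1)) (z t)
      - (2 * stepGain L γ / ξ (t + 1)) • riemGrad E f (x (t + 1)))
    (z (t + 1))

end RiemannianAcceleration

/-! The potential `f (y t) - f xstar + ξ t ^ 2 / (4Δ) * D_{x t}(z t, xstar) ^ 2`, with `Δ = stepGain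
L γ`, shrinks by the factor `1 - ξ (t+1)` at each step (`nesterov_potential_step`). The computation
takes place in the single tangent space at `x (t+1)`, where it is the Euclidean one
(`potential_decrease`). Curvature enters only when the base point of the distance from `z t` to
`xstar` changes; this costs the factor `δ`, which the recursion for `ξ` absorbs. Since `ξ(δ)` is the
fixed point of that recursion, the bound `ξ t ≥ ξ(δ)` persists (`accelRate_le_of_recursion`), and
the rate follows.

The geometry has to supply three facts about `riemLog`: the updates determine its values, its norm
is the distance, and the vectors from `x (t+1)` to `y t` and `z t` are collinear with known ratio
(`riemLog_intermediate`). They rest on the constant speed of geodesics and on their uniqueness for a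
given initial velocity, obtained from the Hamiltonian form of the geodesic equation. -/

/-! ### Geodesics in coordinates: regularity, constant speed, local uniqueness -/

section CoordinateGeodesics

variable {V : Type*} [NormedAddCommGroup V] [NormedSpace ℝ V] [FiniteDimensional ℝ V]

noncomputable local instance {A W : Type*} [NormedAddCommGroup A] [NormedSpace ℝ A]
    [NormedAddCommGroup W] [NormedSpace ℝ W] : NormedAddCommGroup (A →L[ℝ] W) :=
  ContinuousLinearMap.toNormedAddCommGroup

/-- In finite dimension an operator is the tuple of its values on a basis. The geodesic equation
tests the momentum only against constant vectors, and this recovers the derivative of the momentum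
itself. -/
theorem hasDerivAt_clm_of_apply {F : Type*} [NormedAddCommGroup F] [NormedSpace ℝ F]
    {p : ℝ → V →L[ℝ] F} {p' : V →L[ℝ] F} {t : ℝ}
    (h : ∀ w, HasDerivAt (fun s => p s w) (p' w) t) : HasDerivAt p p' t := by
  let d := Module.finrank ℝ V
  have hd : d = Module.finrank ℝ (Fin d → ℝ) := (Module.finrank_fin_fun ℝ).symm
  let e₁ := ContinuousLinearEquiv.ofFinrankEq hd
  let e₂ := (e₁.arrowCongr (1 : F ≃L[ℝ] F)).trans (ContinuousLinearEquiv.piRing (Fin d))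
  have h2 : HasDerivAt (fun s => e₂ (p s)) (e₂ p') t :=
    hasDerivAt_pi.2 fun i => h _
  have h3 := (e₂.symm.hasFDerivAt (x := e₂ (p t))).comp_hasDerivAt t h2
  simpa [Function.comp_def] using h3

theorem ContDiffAt.clm_flip {X A B W : Type*} [NormedAddCommGroup X] [NormedSpace ℝ X]
    [NormedAddCommGroup A] [NormedSpace ℝ A] [NormedAddCommGroup B] [NormedSpace ℝ B]
    [NormedAddCommGroup W] [NormedSpace ℝ W] {f : X → A →L[ℝ] B →L[ℝ] W} {x : X} {n : ℕ∞ω}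
    (hf : ContDiffAt ℝ n f x) : ContDiffAt ℝ n (fun y => (f y).flip) x :=
  (ContinuousLinearMap.flipₗᵢ ℝ A B W).contDiff.contDiffAt.comp x hf

theorem contDiffAt_fderiv_flip_apply {X A B W : Type*} [NormedAddCommGroup X] [NormedSpace ℝ X]
    [NormedAddCommGroup A] [NormedSpace ℝ A] [NormedAddCommGroup B] [NormedSpace ℝ B]
    [NormedAddCommGroup W] [NormedSpace ℝ W] {f : A → B →L[ℝ] W} {g : X → A} {b : X → B} {x : X}
    (hf : ContDiffAt ℝ 2 f (g x)) (hg : ContDiffAt ℝ 1 g x) (hb : ContDiffAt ℝ 1 b x) :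
    ContDiffAt ℝ 1 (fun y => (fderiv ℝ f (g y)).flip (b y)) x :=
  (((hf.fderiv_right (m := 1) (by norm_num)).comp x hg).clm_flip).clm_apply hb

/-- A Riemannian metric in coordinates, of class `C²`, on an open subset of a vector space. -/
structure IsMetricOn (G : V → V →L[ℝ] V →L[ℝ] ℝ) (U : Set V) : Prop where
  isOpen : IsOpen U
  contDiffOn : ContDiffOn ℝ 2 G U
  symm : ∀ q ∈ U, ∀ v w, G q v w = G q w v
  pos : ∀ q ∈ U, ∀ v, v ≠ 0 → 0 < G q v v

/-- The geodesic equation in coordinates, near the time `t`. -/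
def IsCoordGeodesicAt (G : V → V →L[ℝ] V →L[ℝ] ℝ) (u : ℝ → V) (t : ℝ) : Prop :=
  ∀ᶠ s in 𝓝 t, DifferentiableAt ℝ u s ∧ ∀ w, HasDerivAt (fun r => G (u r) (deriv u r) w)
    ((1 / 2) * fderiv ℝ G (u s) w (deriv u s) (deriv u s)) s

/-- The Hamiltonian vector field of the geodesic flow. -/
noncomputable def geodesicField (G : V → V →L[ℝ] V →L[ℝ] ℝ) (y : V × (V →L[ℝ] ℝ)) :
    V × (V →L[ℝ] ℝ) :=
  ((G y.1).inverse y.2,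
    (1 / 2 : ℝ) • ((fderiv ℝ G y.1).flip ((G y.1).inverse y.2)).flip ((G y.1).inverse y.2))

variable {G : V → V →L[ℝ] V →L[ℝ] ℝ} {U : Set V}

theorem IsMetricOn.exists_equiv (hG : IsMetricOn G U) {q : V} (hq : q ∈ U) :
    ∃ e : V ≃L[ℝ] (V →L[ℝ] ℝ), (e : V →L[ℝ] (V →L[ℝ] ℝ)) = G q := by
  have hinj : Function.Injective (G q : V →ₗ[ℝ] (V →L[ℝ] ℝ)) := by
    rw [injective_iff_map_eq_zero]
    intro v hv
    by_contra hne
    have h1 := hG.pos q hq v hne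
    have h2 : G q v = 0 := hv
    simp [h2] at h1
  have hrank : Module.finrank ℝ V = Module.finrank ℝ (V →L[ℝ] ℝ) := by
    rw [← (LinearMap.toContinuousLinearMap (𝕜 := ℝ) (E := V) (F' := ℝ)).finrank_eq]
    exact (Subspace.dual_finrank_eq (K := ℝ) (V := V)).symm
  refine ⟨(LinearEquiv.ofInjectiveOfFinrankEq (G q : V →ₗ[ℝ] (V →L[ℝ] ℝ)) hinj
    hrank).toContinuousLinearEquiv, ?_⟩
  ext v w
  rfl

theorem IsMetricOn.inverse_apply (hG : IsMetricOn G U) {q : V} (hq : q ∈ U) (v : V) :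
    (G q).inverse (G q v) = v := by
  obtain ⟨e, he⟩ := hG.exists_equiv hq
  rw [← he]
  simp

theorem IsMetricOn.contDiffAt_inverse (hG : IsMetricOn G U) {q : V} (hq : q ∈ U) :
    ContDiffAt ℝ 2 (fun q => (G q).inverse) q := by
  obtain ⟨e, he⟩ := hG.exists_equiv hq
  have h := contDiffAt_map_inverse (𝕜 := ℝ) (n := 2) e
  rw [he] at h
  exact h.comp q (hG.contDiffOn.contDiffAt (hG.isOpen.mem_nhds hq))

theorem IsMetricOn.contDiffAt_geodesicField (hG : IsMetricOn G U) {y : V × (V →L[ℝ] ℝ)}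
    (hy : y.1 ∈ U) : ContDiffAt ℝ 1 (geodesicField G) y := by
  have hi : ContDiffAt ℝ 1 (fun y : V × (V →L[ℝ] ℝ) => (G y.1).inverse y.2) y :=
    (((hG.contDiffAt_inverse hy).of_le (by norm_num)).comp y contDiffAt_fst).clm_apply
      contDiffAt_snd
  have hf : ContDiffAt ℝ 1 (fun y : V × (V →L[ℝ] ℝ) =>
      ((fderiv ℝ G y.1).flip ((G y.1).inverse y.2)).flip) y :=
    (contDiffAt_fderiv_flip_apply (hG.contDiffOn.contDiffAt (hG.isOpen.mem_nhds hy))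
      contDiffAt_fst hi).clm_flip
  exact hi.prodMk ((hf.clm_apply hi).const_smul _)

namespace IsCoordGeodesicAt

variable {u v : ℝ → V} {t : ℝ}

theorem hasDerivAt_momentum (hu : IsCoordGeodesicAt G u t) :
    HasDerivAt (fun r => G (u r) (deriv u r))
      ((1 / 2 : ℝ) • ((fderiv ℝ G (u t)).flip (deriv u t)).flip (deriv u t)) t :=
  hasDerivAt_clm_of_apply fun w => by simpa using hu.self_of_nhds.2 w

omit [FiniteDimensional ℝ V] in
theorem eventually_mem (hu : IsCoordGeodesicAt G u t) (hG : IsMetricOn G U) (ht : u t ∈ U) :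
    ∀ᶠ s in 𝓝 t, u s ∈ U :=
  hu.self_of_nhds.1.continuousAt.eventually_mem (hG.isOpen.mem_nhds ht)

theorem deriv_eventuallyEq (hu : IsCoordGeodesicAt G u t) (hG : IsMetricOn G U) (ht : u t ∈ U) :
    deriv u =ᶠ[𝓝 t] fun s => (G (u s)).inverse (G (u s) (deriv u s)) := by
  filter_upwards [hu.eventually_mem hG ht] with s hs
  rw [hG.inverse_apply hs]

/-- Only one derivative of `u` is assumed. The second comes from solving for the velocity: it is the
inverse metric applied to the momentum, and both factors are differentiable. -/
theorem differentiableAt_deriv (hu : IsCoordGeodesicAt G u t) (hG : IsMetricOn G U)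
    (ht : u t ∈ U) : DifferentiableAt ℝ (deriv u) t := by
  refine DifferentiableAt.congr_of_eventuallyEq ?_ (hu.deriv_eventuallyEq hG ht)
  exact DifferentiableAt.clm_apply (DifferentiableAt.comp (g := fun q => (G q).inverse) t
    ((hG.contDiffAt_inverse ht).differentiableAt (by norm_num)) hu.self_of_nhds.1)
    hu.hasDerivAt_momentum.differentiableAt

set_option synthInstance.maxHeartbeats 200000 in
/-- Geodesics have constant speed. -/
theorem hasDerivAt_energy (hu : IsCoordGeodesicAt G u t) (hG : IsMetricOn G U)
    (ht : u t ∈ U) : HasDerivAt (fun s => G (u s) (deriv u s) (deriv u s)) 0 t := by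
  have ha := (hu.differentiableAt_deriv hG ht).hasDerivAt
  have h1 := hu.hasDerivAt_momentum.clm_apply ha
  have hGd : HasDerivAt (fun s => G (u s)) (fderiv ℝ G (u t) (deriv u t)) t :=
    ((hG.contDiffOn.contDiffAt (hG.isOpen.mem_nhds ht)).differentiableAt
      (by norm_num)).hasFDerivAt.comp_hasDerivAt t hu.self_of_nhds.1.hasDerivAt
  have h2 := (hGd.clm_apply ha).clm_apply ha
  -- The energy is differentiated twice: once with the momentum derivative given by the geodesic
  -- equation, `A/2 + B`, and once by the full Leibniz rule, `A + 2B`. Equality forces `A/2 + B =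
  -- 0`.
  have h3 := h1.unique h2
  refine h1.congr_deriv ?_
  simp only [_root_.smul_apply, _root_.add_apply,
    ContinuousLinearMap.flip_apply, smul_eq_mul] at h3 ⊢
  rw [hG.symm _ ht (deriv (deriv u) t)] at h3
  linarith

/-- Position and momentum together solve a first-order ODE whose field is `C¹`, hence locally
Lipschitz, so the initial values determine the solution. -/
theorem eventually_eq (hu : IsCoordGeodesicAt G u t) (hv : IsCoordGeodesicAt G v t)
    (hG : IsMetricOn G U) (ht : u t ∈ U) (h0 : u t = v t) (h1 : deriv u t = deriv v t) :
    u =ᶠ[𝓝 t] v := by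
  have key : ∀ {u : ℝ → V}, IsCoordGeodesicAt G u t → u t ∈ U → ∀ᶠ s in 𝓝 t,
      HasDerivAt (fun s => (u s, G (u s) (deriv u s)))
        (geodesicField G (u s, G (u s) (deriv u s))) s := by
    intro u hu ht
    filter_upwards [eventually_eventually_nhds.2 hu, hu.eventually_mem hG ht] with s hs hsU
    have hs' : IsCoordGeodesicAt G u s := hs
    have := hs'.self_of_nhds.1.hasDerivAt.prodMk hs'.hasDerivAt_momentum
    simpa [geodesicField, hG.inverse_apply hsU] using this
  obtain ⟨K, s, hs, hK⟩ := (hG.contDiffAt_geodesicField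
    (y := (u t, G (u t) (deriv u t))) ht).exists_lipschitzOnWith
  have hmem : ∀ {u : ℝ → V}, IsCoordGeodesicAt G u t → s ∈ 𝓝 (u t, G (u t) (deriv u t)) →
      ∀ᶠ r in 𝓝 t, (u r, G (u r) (deriv u r)) ∈ s := fun hu hs =>
    ContinuousAt.eventually_mem
      (hu.self_of_nhds.1.continuousAt.prodMk hu.hasDerivAt_momentum.continuousAt) hs
  have := ODE_solution_unique_of_eventually (v := fun _ => geodesicField G) (s := fun _ => s)
    (K := K) (t₀ := t) (f := fun s => (u s, G (u s) (deriv u s)))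
    (g := fun s => (v s, G (v s) (deriv v s))) (Eventually.of_forall fun _ => hK)
    ((key hu ht).and (hmem hu hs)) ((key hv (h0 ▸ ht)).and (hmem hv (by rwa [← h0, ← h1])))
    (by simp only [h0, h1])
  exact this.mono fun r hr => congrArg Prod.fst hr

end IsCoordGeodesicAt

end CoordinateGeodesics

/-! ### The Riemannian metric in a chart -/

section ManifoldGeodesics

variable {E : Type*} [NormedAddCommGroup E] [NormedSpace ℝ E] [FiniteDimensional ℝ E]
  {M : Type*} [MetricSpace M] [ChartedSpace E M]
  [RiemannianBundle (fun x : M => TangentSpace 𝓘(ℝ, E) x)]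

/-- The derivative of the inverse of the chart around `x₀`. -/
noncomputable def chartFrame (x₀ : M) (p : E) :
    E →ₗ[ℝ] TangentSpace 𝓘(ℝ, E) ((extChartAt 𝓘(ℝ, E) x₀).symm p) :=
  (mfderiv 𝓘(ℝ, E) 𝓘(ℝ, E) (extChartAt 𝓘(ℝ, E) x₀).symm p).toLinearMap

/-- The Riemannian metric read in the chart around `x₀`, as a bilinear form. -/
noncomputable def chartMetric (x₀ : M) (p : E) : E →L[ℝ] E →L[ℝ] ℝ :=
  LinearMap.toContinuousLinearMap <| (LinearMap.toContinuousLinearMap (𝕜 := ℝ) (E := E)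
    (F' := ℝ)).toLinearMap ∘ₗ (innerₗ (TangentSpace 𝓘(ℝ, E)
      ((extChartAt 𝓘(ℝ, E) x₀).symm p))).compl₁₂ (chartFrame x₀ p) (chartFrame x₀ p)

theorem chartMetric_apply (x₀ : M) (p v w : E) :
    chartMetric x₀ p v w = metricInChart E x₀ p v w := rfl

omit [FiniteDimensional ℝ E] in
theorem metricInChart_comm (x₀ : M) (p v w : E) :
    metricInChart E x₀ p v w = metricInChart E x₀ p w v :=
  real_inner_comm (chartFrame x₀ p w) (chartFrame x₀ p v)

omit [FiniteDimensional ℝ E] in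
theorem metricInChart_smul_left (x₀ : M) (c : ℝ) (p v w : E) :
    metricInChart E x₀ p (c • v) w = c * metricInChart E x₀ p v w :=
  DFunLike.congr_fun (((innerₗ (TangentSpace 𝓘(ℝ, E) ((extChartAt 𝓘(ℝ, E) x₀).symm p))).compl₁₂
    (chartFrame x₀ p) (chartFrame x₀ p)).map_smul c v) w

variable [IsManifold 𝓘(ℝ, E) ∞ M]

omit [FiniteDimensional ℝ E] [RiemannianBundle (fun x : M => TangentSpace 𝓘(ℝ, E) x)] in
theorem contMDiffOn_mfderiv_extChartAt_symm (x₀ : M) (v : E) :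
    ContMDiffOn 𝓘(ℝ, E) 𝓘(ℝ, E).tangent 2 (fun p : E =>
      (⟨(extChartAt 𝓘(ℝ, E) x₀).symm p, mfderiv 𝓘(ℝ, E) 𝓘(ℝ, E) (extChartAt 𝓘(ℝ, E) x₀).symm p v⟩ :
        TangentBundle 𝓘(ℝ, E) M)) (extChartAt 𝓘(ℝ, E) x₀).target := by
  have hopen : IsOpen (extChartAt 𝓘(ℝ, E) x₀).target := isOpen_extChartAt_target x₀
  have h1 : ContMDiffOn 𝓘(ℝ, E) 𝓘(ℝ, E) 3 (extChartAt 𝓘(ℝ, E) x₀).symm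
      (extChartAt 𝓘(ℝ, E) x₀).target :=
    (contMDiffOn_extChartAt_symm (n := ∞) x₀).of_le (by norm_cast)
  have h2 := h1.contMDiffOn_tangentMapWithin (m := 2) (by norm_num) hopen.uniqueMDiffOn
  have h3 : ContMDiffOn 𝓘(ℝ, E) 𝓘(ℝ, E).tangent 2
      (fun p : E => (⟨p, v⟩ : TangentBundle 𝓘(ℝ, E) E)) (extChartAt 𝓘(ℝ, E) x₀).target := by
    intro p hp
    rw [contMDiffWithinAt_totalSpace]
    refine ⟨contMDiffWithinAt_id, ?_⟩
    simpa using contMDiffWithinAt_const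
  refine (h2.comp h3 fun p hp => hp).congr fun p hp => ?_
  simp only [Function.comp_apply, tangentMapWithin]
  rw [mfderivWithin_of_isOpen hopen hp]

variable [IsContMDiffRiemannianBundle 𝓘(ℝ, E) ∞ E (fun x : M => TangentSpace 𝓘(ℝ, E) x)]

omit [FiniteDimensional ℝ E] in
theorem contDiffOn_metricInChart (x₀ : M) (v w : E) :
    ContDiffOn ℝ 2 (fun p => metricInChart E x₀ p v w) (extChartAt 𝓘(ℝ, E) x₀).target := by
  rw [← contMDiffOn_iff_contDiffOn]
  exact ContMDiffOn.inner_bundle (contMDiffOn_mfderiv_extChartAt_symm x₀ v)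
    (contMDiffOn_mfderiv_extChartAt_symm x₀ w)

omit [FiniteDimensional ℝ E] [RiemannianBundle (fun x : M => TangentSpace 𝓘(ℝ, E) x)]
  [IsContMDiffRiemannianBundle 𝓘(ℝ, E) ∞ E (fun x : M => TangentSpace 𝓘(ℝ, E) x)] in
theorem mfderiv_extChartAt_symm_injective (x₀ : M) {p : E}
    (hp : p ∈ (extChartAt 𝓘(ℝ, E) x₀).target) :
    Function.Injective (mfderiv 𝓘(ℝ, E) 𝓘(ℝ, E) (extChartAt 𝓘(ℝ, E) x₀).symm p) := by
  have h := mfderiv_extChartAt_comp_mfderivWithin_extChartAt_symm (I := 𝓘(ℝ, E)) hp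
  intro v w hvw
  have hv := DFunLike.congr_fun h v
  have hw := DFunLike.congr_fun h w
  simp only [modelWithCornersSelf_coe, range_id, mfderivWithin_univ,
    ContinuousLinearMap.comp_apply] at hv hw
  rw [hvw, hw] at hv
  exact hv.symm

theorem isMetricOn_chartMetric (x₀ : M) :
    IsMetricOn (chartMetric x₀ : E → E →L[ℝ] E →L[ℝ] ℝ) (extChartAt 𝓘(ℝ, E) x₀).target where
  isOpen := isOpen_extChartAt_target x₀
  contDiffOn := contDiffOn_clm_apply.2 fun v => contDiffOn_clm_apply.2 fun w =>
    contDiffOn_metricInChart x₀ v w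
  symm _ _ _ _ := metricInChart_comm _ _ _ _
  pos p hp v hv := by
    rw [chartMetric_apply, metricInChart, real_inner_self_eq_norm_sq]
    have : mfderiv 𝓘(ℝ, E) 𝓘(ℝ, E) (extChartAt 𝓘(ℝ, E) x₀).symm p v ≠ 0 := fun h =>
      hv (mfderiv_extChartAt_symm_injective x₀ hp (h.trans (map_zero _).symm))
    exact pow_pos (norm_pos_iff.2 this) 2

end ManifoldGeodesics

/-! ### Geodesics on the manifold: velocity, uniqueness, constant speed -/

section ManifoldGeodesics

variable {E : Type*} [NormedAddCommGroup E] [NormedSpace ℝ E]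
  {M : Type*} [MetricSpace M] [ChartedSpace E M]

/-- The velocity of a curve, as a point of the tangent bundle. -/
noncomputable def curveVelocity (g : ℝ → M) (t : ℝ) : TangentBundle 𝓘(ℝ, E) M :=
  ⟨g t, mfderiv 𝓘(ℝ, ℝ) 𝓘(ℝ, E) g t (1 : ℝ)⟩

theorem curveVelocity_congr {g h : ℝ → M} {t : ℝ} (hgh : g =ᶠ[𝓝 t] h) :
    (curveVelocity g t : TangentBundle 𝓘(ℝ, E) M) = curveVelocity h t := by
  refine TotalSpace.ext hgh.self_of_nhds ?_
  simp only [curveVelocity]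
  rw [hgh.mfderiv_eq, hgh.self_of_nhds]

/-- The one-sided derivative at `0` already determines the two-sided one. Unique geodesics are
compared only on `[0, 1]`, whereas `IsExp` uses the full derivative at `0`. -/
theorem curveVelocity_eqOn_Icc {g h : ℝ → M} (hg : MDifferentiableAt 𝓘(ℝ, ℝ) 𝓘(ℝ, E) g 0)
    (hh : MDifferentiableAt 𝓘(ℝ, ℝ) 𝓘(ℝ, E) h 0) (hgh : EqOn g h (Icc 0 1)) :
    (curveVelocity g 0 : TangentBundle 𝓘(ℝ, E) M) = curveVelocity h 0 := by
  have h0 : (0 : ℝ) ∈ Icc (0 : ℝ) 1 := ⟨le_rfl, zero_le_one⟩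
  have hu : UniqueMDiffWithinAt 𝓘(ℝ, ℝ) (Icc (0 : ℝ) 1) 0 :=
    (uniqueDiffOn_Icc zero_lt_one 0 h0).uniqueMDiffWithinAt
  refine TotalSpace.ext (hgh h0) ?_
  simp only [curveVelocity]
  rw [← mfderivWithin_eq_mfderiv hu hg, ← mfderivWithin_eq_mfderiv hu hh,
    mfderivWithin_congr hgh (hgh h0), hgh h0]

variable [IsManifold 𝓘(ℝ, E) ∞ M]

theorem curveVelocity_eq_chartFrame {g : ℝ → M} {t : ℝ} {x₀ : M} (hc : ContinuousAt g t)
    (hx : g t ∈ (chartAt E x₀).source)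
    (hd : DifferentiableAt ℝ (fun s => extChartAt 𝓘(ℝ, E) x₀ (g s)) t) :
    MDifferentiableAt 𝓘(ℝ, ℝ) 𝓘(ℝ, E) g t ∧
    (curveVelocity g t : TangentBundle 𝓘(ℝ, E) M) =
      ⟨(extChartAt 𝓘(ℝ, E) x₀).symm (extChartAt 𝓘(ℝ, E) x₀ (g t)),
        chartFrame x₀ (extChartAt 𝓘(ℝ, E) x₀ (g t))
          (deriv (fun s => extChartAt 𝓘(ℝ, E) x₀ (g s)) t)⟩ := by
  have hev : g =ᶠ[𝓝 t] (extChartAt 𝓘(ℝ, E) x₀).symm ∘ fun s => extChartAt 𝓘(ℝ, E) x₀ (g s) := by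
    filter_upwards [hc.eventually_mem ((chartAt E x₀).open_source.mem_nhds hx)] with s hs
    exact ((extChartAt 𝓘(ℝ, E) x₀).left_inv (by rwa [extChartAt_source])).symm
  have hxt : extChartAt 𝓘(ℝ, E) x₀ (g t) ∈ (extChartAt 𝓘(ℝ, E) x₀).target :=
    (extChartAt 𝓘(ℝ, E) x₀).map_source (by rwa [extChartAt_source])
  have hs : MDifferentiableAt 𝓘(ℝ, E) 𝓘(ℝ, E) (extChartAt 𝓘(ℝ, E) x₀).symm
      (extChartAt 𝓘(ℝ, E) x₀ (g t)) :=
    mdifferentiableOn_extChartAt_symm.mdifferentiableAt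
      ((isOpen_extChartAt_target x₀).mem_nhds hxt)
  have hm : MDifferentiableAt 𝓘(ℝ, ℝ) 𝓘(ℝ, E) (fun s => extChartAt 𝓘(ℝ, E) x₀ (g s)) t :=
    hd.mdifferentiableAt
  refine ⟨(hs.comp t hm).congr_of_eventuallyEq hev, ?_⟩
  rw [curveVelocity_congr hev]
  refine TotalSpace.ext rfl (heq_of_eq ?_)
  simp only [curveVelocity]
  rw [mfderiv_comp t hs hm, mfderiv_eq_fderiv]
  simp only [chartFrame]
  rw [← fderiv_apply_one_eq_deriv]
  rfl

variable [RiemannianBundle (fun x : M => TangentSpace 𝓘(ℝ, E) x)]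

namespace IsGeodesicOn

variable {g h : ℝ → M} {J : Set ℝ} {t : ℝ}

omit [IsManifold 𝓘(ℝ, E) ∞ M] in
theorem mono (hg : IsGeodesicOn E g J) {J' : Set ℝ} (hJ : J' ⊆ J) : IsGeodesicOn E g J' :=
  ⟨fun t ht => hg.1 t (hJ ht), fun t ht => hg.2 t (hJ ht), fun t ht => hg.3 t (hJ ht)⟩

theorem velocity_eq_chartFrame (hg : IsGeodesicOn E g J) (ht : t ∈ J) {x₀ : M}
    (hx : g t ∈ (chartAt E x₀).source) :
    (curveVelocity g t : TangentBundle 𝓘(ℝ, E) M) =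
      ⟨(extChartAt 𝓘(ℝ, E) x₀).symm (extChartAt 𝓘(ℝ, E) x₀ (g t)),
        chartFrame x₀ (extChartAt 𝓘(ℝ, E) x₀ (g t))
          (deriv (fun s => extChartAt 𝓘(ℝ, E) x₀ (g s)) t)⟩ :=
  (curveVelocity_eq_chartFrame (hg.1 t ht) hx (hg.2 t ht x₀ hx)).2

theorem mdifferentiableAt (hg : IsGeodesicOn E g J) (ht : t ∈ J) :
    MDifferentiableAt 𝓘(ℝ, ℝ) 𝓘(ℝ, E) g t :=
  have hx := mem_chart_source E (g t)
  (curveVelocity_eq_chartFrame (hg.1 t ht) hx (hg.2 t ht _ hx)).1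

theorem deriv_eq_of_velocity_eq (hg : IsGeodesicOn E g J) (hh : IsGeodesicOn E h J) (ht : t ∈ J)
    {x₀ : M} (hx : g t ∈ (chartAt E x₀).source)
    (hv : (curveVelocity g t : TangentBundle 𝓘(ℝ, E) M) = curveVelocity h t) :
    deriv (fun s => extChartAt 𝓘(ℝ, E) x₀ (g s)) t =
      deriv (fun s => extChartAt 𝓘(ℝ, E) x₀ (h s)) t := by
  have h0 : g t = h t := congrArg TotalSpace.proj hv
  rw [hg.velocity_eq_chartFrame ht hx, hh.velocity_eq_chartFrame ht (h0 ▸ hx), ← h0,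
    TotalSpace.mk_inj] at hv
  exact mfderiv_extChartAt_symm_injective x₀
    ((extChartAt 𝓘(ℝ, E) x₀).map_source (by rwa [extChartAt_source])) hv

omit [IsManifold 𝓘(ℝ, E) ∞ M] in
/-- Affine reparametrizations of geodesics are geodesics. -/
theorem comp_affine (hg : IsGeodesicOn E g J) (a b : ℝ) :
    IsGeodesicOn E (fun s => g (a + b * s)) {s | a + b * s ∈ J} where
  continuousAt t ht := ContinuousAt.comp (f := fun s => a + b * s) (hg.1 _ ht) (by fun_prop)
  differentiableAt t ht x₀ hx :=
    DifferentiableAt.comp (g := fun s => extChartAt 𝓘(ℝ, E) x₀ (g s)) t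
      (hg.2 _ ht x₀ hx) (by fun_prop)
  geodesicEquation t ht x₀ hx w := by
    have hd : deriv (fun s => extChartAt 𝓘(ℝ, E) x₀ (g (a + b * s))) =
        fun s => b • deriv (fun s => extChartAt 𝓘(ℝ, E) x₀ (g s)) (a + b * s) := by
      funext s
      rw [deriv_comp_mul_left (f := fun r => extChartAt 𝓘(ℝ, E) x₀ (g (a + r))),
        deriv_comp_const_add (f := fun r => extChartAt 𝓘(ℝ, E) x₀ (g r))]
    -- Both sides of the equation scale by `b * b`: the right side is quadratic in the velocity, the
    -- left gets one factor from the velocity and one from the chain rule.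
    have hbb : ∀ v : E, (fun p => metricInChart E x₀ p (b • v) (b • v)) =
        (b * b) • fun p => metricInChart E x₀ p v v := fun v => by
      funext p
      rw [metricInChart_smul_left, metricInChart_comm, metricInChart_smul_left, Pi.smul_apply,
        smul_eq_mul, mul_assoc]
    have haff : HasDerivAt (fun s => a + b * s) b t := by
      simpa using ((hasDerivAt_id t).const_mul b).const_add a
    have h1 := (HasDerivAt.comp t (hg.3 _ ht x₀ hx w) haff).const_mul b
    simp only [hd, metricInChart_smul_left _ b _ _ w, hbb]
    refine h1.congr_deriv ?_
    rw [fderiv_const_smul_field]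
    simp only [Pi.smul_apply, _root_.smul_apply, smul_eq_mul]
    ring

variable [FiniteDimensional ℝ E]
  [IsContMDiffRiemannianBundle 𝓘(ℝ, E) ∞ E (fun x : M => TangentSpace 𝓘(ℝ, E) x)]

theorem isCoordGeodesicAt (hg : IsGeodesicOn E g J) (hJ : IsOpen J) (ht : t ∈ J) {x₀ : M}
    (hx : g t ∈ (chartAt E x₀).source) :
    IsCoordGeodesicAt (chartMetric x₀) (fun s => extChartAt 𝓘(ℝ, E) x₀ (g s)) t := by
  filter_upwards [hJ.mem_nhds ht, (hg.1 t ht).eventually_mem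
    ((chartAt E x₀).open_source.mem_nhds hx)] with s hs hxs
  refine ⟨hg.2 s hs x₀ hxs, fun w => ?_⟩
  refine (hg.3 s hs x₀ hxs w).congr_deriv (congrArg ((1 / 2 : ℝ) * ·) ?_)
  have hm := isMetricOn_chartMetric (E := E) x₀
  have hxt : extChartAt 𝓘(ℝ, E) x₀ (g s) ∈ (extChartAt 𝓘(ℝ, E) x₀).target :=
    (extChartAt 𝓘(ℝ, E) x₀).map_source (by rwa [extChartAt_source])
  have hd := ((hm.contDiffOn.contDiffAt (hm.isOpen.mem_nhds hxt)).differentiableAt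
    (by norm_num)).hasFDerivAt
  set v := deriv (fun r => extChartAt 𝓘(ℝ, E) x₀ (g r)) s
  have h2 := (hd.clm_apply (hasFDerivAt_const v _)).clm_apply (hasFDerivAt_const v _)
  simp only [chartMetric_apply] at h2
  rw [h2.fderiv]
  simp

theorem eventually_eq (hg : IsGeodesicOn E g J) (hh : IsGeodesicOn E h J) (hJ : IsOpen J)
    (ht : t ∈ J) (h0 : g t = h t)
    (h1 : deriv (fun s => extChartAt 𝓘(ℝ, E) (g t) (g s)) t =
      deriv (fun s => extChartAt 𝓘(ℝ, E) (g t) (h s)) t) : g =ᶠ[𝓝 t] h := by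
  have hx := mem_chart_source E (g t)
  have hxh : h t ∈ (chartAt E (g t)).source := h0 ▸ hx
  have key := (hg.isCoordGeodesicAt hJ ht hx).eventually_eq (hh.isCoordGeodesicAt hJ ht hxh)
    (isMetricOn_chartMetric _) (mem_extChartAt_target _) (by simp only [h0]) h1
  filter_upwards [key, (hg.1 t ht).eventually_mem ((chartAt E (g t)).open_source.mem_nhds hx),
    (hh.1 t ht).eventually_mem ((chartAt E (g t)).open_source.mem_nhds hxh)] with s hs hgs hhs
  exact (extChartAt 𝓘(ℝ, E) (g t)).injOn (by rwa [extChartAt_source])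
    (by rwa [extChartAt_source]) hs

/-- A geodesic is determined by its velocity at one time. -/
theorem eqOn_of_velocity_eq (hg : IsGeodesicOn E g J) (hh : IsGeodesicOn E h J) (hJ : IsOpen J)
    (hJc : IsPreconnected J) (ht : t ∈ J)
    (hv : (curveVelocity g t : TangentBundle 𝓘(ℝ, E) M) = curveVelocity h t) : EqOn g h J := by
  -- The set of times near which the curves agree is open; it is also closed in `J`, because
  -- positions and chart velocities are continuous and so agree at limit points, where local
  -- uniqueness applies.
  have hsub : J ⊆ {s | g =ᶠ[𝓝 s] h} := by
    refine hJc.subset_of_closure_inter_subset isOpen_setOfPred_eventually_nhds ⟨t, ht, ?_⟩ ?_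
    · exact hg.eventually_eq hh hJ ht (congrArg TotalSpace.proj hv)
        (hg.deriv_eq_of_velocity_eq hh ht (mem_chart_source E _) hv)
    · rintro s ⟨hs, hsJ⟩
      have hfr : ∃ᶠ r in 𝓝 s, g =ᶠ[𝓝 r] h := mem_closure_iff_frequently.1 hs
      have h0 : g s = h s := by
        by_contra hne
        have hev := (((hg.1 s hsJ).prodMk (hh.1 s hsJ)).eventually_mem
          (isClosed_diagonal.isOpen_compl.mem_nhds (by simpa using hne)))
        obtain ⟨r, hr, hr'⟩ := (hfr.and_eventually hev).exists
        exact hr' hr.self_of_nhds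
      refine hg.eventually_eq hh hJ hsJ h0 ?_
      have hx := mem_chart_source E (g s)
      have hxh : h s ∈ (chartAt E (g s)).source := h0 ▸ hx
      have hgc := ((hg.isCoordGeodesicAt hJ hsJ hx).differentiableAt_deriv
        (isMetricOn_chartMetric _) (mem_extChartAt_target _)).continuousAt
      have hhc := ((hh.isCoordGeodesicAt hJ hsJ hxh).differentiableAt_deriv
        (isMetricOn_chartMetric _) (by simp only [← h0]; exact mem_extChartAt_target _)).continuousAt
      by_contra hne
      have hev := (hgc.prodMk hhc).eventually_mem
          (isClosed_diagonal.isOpen_compl.mem_nhds (by simpa using hne))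
      obtain ⟨r, hr, hr'⟩ := (hfr.and_eventually hev).exists
      have hr2 : (fun q => extChartAt 𝓘(ℝ, E) (g s) (g q)) =ᶠ[𝓝 r]
        fun q => extChartAt 𝓘(ℝ, E) (g s) (h q) := hr.fun_comp _
      exact hr' hr2.deriv_eq
  exact fun s hs => (hsub hs).self_of_nhds

/-- Geodesics have constant speed. -/
theorem norm_mfderiv_eq (hg : IsGeodesicOn E g J) (hJ : IsOpen J) (hJc : IsPreconnected J)
    {s : ℝ} (hs : s ∈ J) (ht : t ∈ J) :
    ‖mfderiv 𝓘(ℝ, ℝ) 𝓘(ℝ, E) g s (1 : ℝ)‖ = ‖mfderiv 𝓘(ℝ, ℝ) 𝓘(ℝ, E) g t (1 : ℝ)‖ := by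
  have hd : ∀ r ∈ J, HasDerivAt (fun r => ‖mfderiv 𝓘(ℝ, ℝ) 𝓘(ℝ, E) g r (1 : ℝ)‖ ^ 2) 0 r := by
    intro r hr
    have hx := mem_chart_source E (g r)
    refine ((hg.isCoordGeodesicAt hJ hr hx).hasDerivAt_energy
      (isMetricOn_chartMetric _) (mem_extChartAt_target _)).congr_of_eventuallyEq ?_
    filter_upwards [hJ.mem_nhds hr, (hg.1 r hr).eventually_mem
      ((chartAt E (g r)).open_source.mem_nhds hx)] with q hq hxq
    have h1 : ‖mfderiv 𝓘(ℝ, ℝ) 𝓘(ℝ, E) g q (1 : ℝ)‖ ^ 2 =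
      ‖(curveVelocity g q : TangentBundle 𝓘(ℝ, E) M).2‖ ^ 2 := rfl
    rw [h1, hg.velocity_eq_chartFrame hq hxq]
    exact (real_inner_self_eq_norm_sq _).symm
  have hc := hJ.is_const_of_deriv_eq_zero hJc
    (fun r hr => (hd r hr).differentiableAt.differentiableWithinAt) (fun r hr => (hd r hr).deriv)
    hs ht
  exact (sq_eq_sq₀ (norm_nonneg _) (norm_nonneg _)).1 hc

end IsGeodesicOn

end ManifoldGeodesics

/-! ### The exponential map and its inverse -/

section ExponentialMap

variable {E : Type*} [NormedAddCommGroup E] [NormedSpace ℝ E]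
  {M : Type*} [MetricSpace M] [ChartedSpace E M]

theorem curveVelocity_comp_affine {g : ℝ → M} {a b s : ℝ}
    (hg : MDifferentiableAt 𝓘(ℝ, ℝ) 𝓘(ℝ, E) g (a + b * s)) :
    (curveVelocity (fun r => g (a + b * r)) s : TangentBundle 𝓘(ℝ, E) M) =
      ⟨g (a + b * s), b • mfderiv 𝓘(ℝ, ℝ) 𝓘(ℝ, E) g (a + b * s) (1 : ℝ)⟩ := by
  have haff : HasDerivAt (fun r => a + b * r) b s := by
    simpa using ((hasDerivAt_id s).const_mul b).const_add a
  have hc : mfderiv 𝓘(ℝ, ℝ) 𝓘(ℝ, E) (fun r => g (a + b * r)) s =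
      (mfderiv 𝓘(ℝ, ℝ) 𝓘(ℝ, E) g (a + b * s)).comp
        (mfderiv 𝓘(ℝ, ℝ) 𝓘(ℝ, ℝ) (fun r => a + b * r) s) :=
    mfderiv_comp s hg haff.differentiableAt.mdifferentiableAt
  have hb : mfderiv 𝓘(ℝ, ℝ) 𝓘(ℝ, ℝ) (fun r => a + b * r) s (1 : ℝ) = b • (1 : ℝ) := by
    rw [mfderiv_eq_fderiv]
    exact fderiv_apply_one_eq_deriv.trans (haff.deriv.trans (by simp))
  refine TotalSpace.ext rfl (heq_of_eq ?_)
  simp only [curveVelocity]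
  rw [hc]
  exact (congrArg (mfderiv 𝓘(ℝ, ℝ) 𝓘(ℝ, E) g (a + b * s)) hb).trans (map_smul _ b (1 : ℝ))

variable [IsManifold 𝓘(ℝ, E) ∞ M] [RiemannianBundle (fun x : M => TangentSpace 𝓘(ℝ, E) x)]

omit [IsManifold 𝓘(ℝ, E) ∞ M] in
theorem IsGeodesicOn.isGeodesicSegment {g : ℝ → M} {ε : ℝ} (hε : 0 < ε)
    (hg : IsGeodesicOn E g (Ioo (-ε) (1 + ε))) {a b : ℝ} (ha : a ∈ Icc (0 : ℝ) 1)
    (hb : a + b ∈ Icc (0 : ℝ) 1) :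
    IsGeodesicSegment E (fun s => g (a + b * s)) (g a) (g (a + b)) where
  isGeodesicOn := by
    refine ⟨ε, hε, (hg.comp_affine a b).mono ?_⟩
    rintro s ⟨hs1, hs2⟩
    obtain ⟨ha0, ha1⟩ := ha
    obtain ⟨hb0, hb1⟩ := hb
    have p1 : 0 ≤ (1 - b) * ε := mul_nonneg (by linarith) hε.le
    have p2 : 0 ≤ (1 + b) * ε := mul_nonneg (by linarith) hε.le
    -- As `|b| ≤ 1`, the affine map sends the enlarged interval into itself; negative `b` traverses
    -- the geodesic backwards.
    rcases lt_trichotomy b 0 with h | rfl | h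
    · have p3 := mul_pos_of_neg_of_neg h (by linarith : s - (1 + ε) < 0)
      have p4 := mul_neg_of_neg_of_pos h (by linarith : 0 < s + ε)
      constructor <;> linarith
    · constructor <;> linarith
    · have p3 := mul_neg_of_pos_of_neg h (by linarith : s - (1 + ε) < 0)
      have p4 := mul_pos h (by linarith : 0 < s + ε)
      constructor <;> linarith
  source := by simp
  target := by simp

theorem IsGeodesicOn.isExp {g : ℝ → M} {ε : ℝ} (hε : 0 < ε)
    (hg : IsGeodesicOn E g (Ioo (-ε) (1 + ε))) {a b : ℝ} (ha : a ∈ Icc (0 : ℝ) 1)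
    (hb : a + b ∈ Icc (0 : ℝ) 1) :
    IsExp (g a) (b • mfderiv 𝓘(ℝ, ℝ) 𝓘(ℝ, E) g a (1 : ℝ)) (g (a + b)) := by
  refine ⟨_, hg.isGeodesicSegment hε ha hb, ?_⟩
  have hd := hg.mdifferentiableAt (t := a + b * 0) (by
    rw [mul_zero, add_zero]; exact ⟨by linarith [ha.1], by linarith [ha.2]⟩)
  refine (curveVelocity_comp_affine hd).trans ?_
  rw [mul_zero, add_zero]

theorem IsGeodesicSegment.mdifferentiableAt_zero {g : ℝ → M} {x y : M}
    (hg : IsGeodesicSegment E g x y) : MDifferentiableAt 𝓘(ℝ, ℝ) 𝓘(ℝ, E) g 0 := by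
  obtain ⟨ε, hε, h⟩ := hg.isGeodesicOn
  exact h.mdifferentiableAt ⟨by linarith, by linarith⟩

theorem UniquelyGeodesic.isExp_unique (hM : UniquelyGeodesic E M) {x y : M}
    {v w : TangentSpace 𝓘(ℝ, E) x} (hv : IsExp x v y) (hw : IsExp x w y) : v = w := by
  obtain ⟨g, hg, hgv⟩ := hv
  obtain ⟨h, hh, hhw⟩ := hw
  have := curveVelocity_eqOn_Icc (E := E) hg.mdifferentiableAt_zero hh.mdifferentiableAt_zero
    ((hM x y).2 g h hg hh)
  exact (TotalSpace.mk_inj (F := E)).1 ((hgv.symm.trans this).trans hhw)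

/-- This makes the choice in `riemLog` harmless: each update by `IsExp` becomes a formula for an
inverse exponential. -/
theorem IsExp.riemLog_eq (hM : UniquelyGeodesic E M) {x y : M} {v : TangentSpace 𝓘(ℝ, E) x}
    (hv : IsExp x v y) : riemLog E x y = v :=
  hM.isExp_unique (Classical.epsilon_spec (p := fun v : TangentSpace 𝓘(ℝ, E) x => IsExp x v y) ⟨v, hv⟩) hv

variable [FiniteDimensional ℝ E]
  [IsContMDiffRiemannianBundle 𝓘(ℝ, E) ∞ E (fun x : M => TangentSpace 𝓘(ℝ, E) x)]

theorem IsGeodesicSegment.pathELength_eq {g : ℝ → M} {x y : M} (hg : IsGeodesicSegment E g x y) :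
    Manifold.pathELength 𝓘(ℝ, E) g 0 1 =
      ENNReal.ofReal ‖mfderiv 𝓘(ℝ, ℝ) 𝓘(ℝ, E) g 0 (1 : ℝ)‖ := by
  obtain ⟨ε, hε, h⟩ := hg.isGeodesicOn
  rw [Manifold.pathELength_eq_lintegral_mfderiv_Icc]
  have hc : ∀ t ∈ Icc (0 : ℝ) 1, ‖mfderiv 𝓘(ℝ, ℝ) 𝓘(ℝ, E) g t (1 : ℝ)‖ₑ =
      ENNReal.ofReal ‖mfderiv 𝓘(ℝ, ℝ) 𝓘(ℝ, E) g 0 (1 : ℝ)‖ := fun t ht => by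
    rw [← ofReal_norm, h.norm_mfderiv_eq isOpen_Ioo isPreconnected_Ioo
      (s := t) (t := 0) ⟨by linarith [ht.1], by linarith [ht.2]⟩ ⟨by linarith, by linarith⟩]
  refine (MeasureTheory.setLIntegral_congr_fun measurableSet_Icc hc).trans ?_
  simp

/-- At constant speed over unit time, the length of the shortest geodesic is its initial speed. -/
theorem UniquelyGeodesic.exists_isExp (hM : UniquelyGeodesic E M) (x y : M) :
    ∃ v : TangentSpace 𝓘(ℝ, E) x, IsExp x v y ∧ ‖v‖ = dist x y := by
  obtain ⟨g, hg, hlen⟩ := (hM x y).1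
  obtain rfl := hg.source
  refine ⟨_, ⟨g, hg, rfl⟩, ?_⟩
  rw [hg.pathELength_eq, edist_dist] at hlen
  exact (ENNReal.ofReal_eq_ofReal_iff (norm_nonneg _) dist_nonneg).1 hlen

theorem UniquelyGeodesic.isExp_riemLog (hM : UniquelyGeodesic E M) (x y : M) :
    IsExp (E := E) x (riemLog E x y) y := by
  obtain ⟨v, hv, -⟩ := hM.exists_isExp x y
  rwa [hv.riemLog_eq hM]

theorem UniquelyGeodesic.norm_riemLog (hM : UniquelyGeodesic E M) (x y : M) :
    ‖(riemLog E x y : TangentSpace 𝓘(ℝ, E) x)‖ = dist x y := by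
  obtain ⟨v, hv, hd⟩ := hM.exists_isExp x y
  rwa [hv.riemLog_eq hM]

/-- If `g` is the geodesic from `y` to `z`, then `x = g α`, and the vectors at `x` towards `y` and
`z` are `-α` and `1 - α` times the velocity of `g` at `α`. That `x = g α` needs uniqueness from the
initial velocity, as the endpoint is not known beforehand. -/
theorem UniquelyGeodesic.riemLog_intermediate (hM : UniquelyGeodesic E M) {x y z : M} {α : ℝ}
    (hα : α ∈ Icc (0 : ℝ) 1)
    (hx : IsExp y (α • (riemLog E y z : TangentSpace 𝓘(ℝ, E) y)) x) :
    (1 - α) • (riemLog E x y : TangentSpace 𝓘(ℝ, E) x) + α • riemLog E x z = 0 := by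
  obtain ⟨g, hg, hgv⟩ := hM.isExp_riemLog (E := E) y z
  obtain ⟨h, hh, hhv⟩ := hx
  obtain ⟨ε, hε, hgε⟩ := hg.isGeodesicOn
  obtain ⟨η, hη, hhη⟩ := hh.isGeodesicOn
  have hsub := hgε.isGeodesicSegment hε (a := 0) (b := α) ⟨le_rfl, zero_le_one⟩ (by simpa using hα)
  obtain ⟨θ, hθ, hgθ⟩ := hsub.isGeodesicOn
  set κ := min θ η with hκ
  have hκ0 : 0 < κ := lt_min hθ hη
  have h0 : (0 : ℝ) ∈ Ioo (-κ) (1 + κ) := ⟨by linarith, by linarith⟩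
  have hvel : (curveVelocity (fun s => g (0 + α * s)) 0 : TangentBundle 𝓘(ℝ, E) M) =
      curveVelocity h 0 := by
    have hgv' : (curveVelocity g 0 : TangentBundle 𝓘(ℝ, E) M) = ⟨y, riemLog E y z⟩ := hgv
    have hs : (⟨g 0, α • mfderiv 𝓘(ℝ, ℝ) 𝓘(ℝ, E) g 0 (1 : ℝ)⟩ : TangentBundle 𝓘(ℝ, E) M) =
        ⟨y, α • riemLog E y z⟩ :=
      congrArg (fun X : TangentBundle 𝓘(ℝ, E) M =>
        (⟨X.1, α • X.2⟩ : TangentBundle 𝓘(ℝ, E) M)) hgv'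
    rw [curveVelocity_comp_affine (by simpa using hg.mdifferentiableAt_zero), mul_zero, add_zero]
    exact hs.trans hhv.symm
  have hEq := (hgθ.mono (Ioo_subset_Ioo (by simp [hκ]) (by simp [hκ]))).eqOn_of_velocity_eq
    (hhη.mono (Ioo_subset_Ioo (by simp [hκ]) (by simp [hκ]))) isOpen_Ioo isPreconnected_Ioo h0 hvel
  have hgx : g α = x := by
    have := hEq (x := 1) ⟨by linarith, by linarith⟩
    simpa [hh.target] using this
  have hz := (hgε.isExp hε hα (b := 1 - α) (by simp)).riemLog_eq hM
  have hy := (hgε.isExp hε hα (b := -α) (by simp)).riemLog_eq hM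
  rw [add_sub_cancel, hg.target] at hz
  rw [add_neg_cancel, hg.source] at hy
  subst hgx
  rw [hz, hy, smul_smul, smul_smul, ← add_smul]
  convert zero_smul ℝ _ using 2
  ring

end ExponentialMap

/-! ### The rate as fixed point of the recursion -/

section Rate

variable {μ Δ δ : ℝ}

/-- This is the fixed-point equation of the recursion for `ξ`, cleared of denominators; monotonicity
and the limit are read off from it. -/
theorem accelRate_quadratic (ha0 : 0 < 2 * μ * Δ) (hδ : 1 ≤ δ) :
    δ * (accelRate μ Δ δ - 2 * μ * Δ) = accelRate μ Δ δ * (1 - accelRate μ Δ δ) := by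
  have h := Real.sq_sqrt (show 0 ≤ (δ - 1) ^ 2 + 8 * δ * μ * Δ by nlinarith [sq_nonneg (δ - 1)])
  unfold accelRate
  linear_combination h / 4

theorem accelRate_mem (ha0 : 0 < 2 * μ * Δ) (ha1 : 2 * μ * Δ < 1) (hδ : 1 ≤ δ) :
    accelRate μ Δ δ ∈ Ioo (2 * μ * Δ) 1 := by
  -- With `a = 2 * μ * Δ`, squaring reduces this to `a ^ 2 < a`.
  have h1 : δ - 1 + 2 * (2 * μ * Δ) < √((δ - 1) ^ 2 + 8 * δ * μ * Δ) := by
    apply Real.lt_sqrt_of_sq_lt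
    nlinarith [mul_pos ha0 (sub_pos.2 ha1)]
  have h2 : √((δ - 1) ^ 2 + 8 * δ * μ * Δ) < δ + 1 := by
    rw [Real.sqrt_lt' (by linarith)]
    nlinarith
  unfold accelRate
  constructor <;> linarith

theorem strictAntiOn_accelRate (ha0 : 0 < 2 * μ * Δ) (ha1 : 2 * μ * Δ < 1) :
    StrictAntiOn (accelRate μ Δ) (Ici 1) := by
  intro d hd e he hde
  have h1 := accelRate_quadratic ha0 hd
  have h2 := accelRate_quadratic ha0 he
  have m1 := accelRate_mem ha0 ha1 hd
  have m2 := accelRate_mem ha0 ha1 he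
  rw [mem_Ici] at hd he
  by_contra! hle
  -- With `q` the rate and `a = 2 * μ * Δ`, subtracting the quadratics gives `(q e - q d) * (q d + q
  -- e + e - 1) + (e - d) * (q d - a) = 0`, impossible if `q d ≤ q e`.
  have hp := mul_pos (sub_pos.2 hde) (sub_pos.2 m1.1)
  nlinarith [mul_nonneg (sub_nonneg.2 hle)
    (by linarith [m1.1, m2.1] : 0 ≤ accelRate μ Δ d + accelRate μ Δ e + (e - 1))]

theorem accelRate_one : accelRate μ Δ 1 = √(2 * μ * Δ) := by
  have : (1 - 1 : ℝ) ^ 2 + 8 * 1 * μ * Δ = 2 ^ 2 * (2 * μ * Δ) := by ring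
  rw [accelRate, this, Real.sqrt_mul (by norm_num), Real.sqrt_sq (by norm_num)]
  ring

theorem tendsto_accelRate (ha0 : 0 < 2 * μ * Δ) (ha1 : 2 * μ * Δ < 1) :
    Tendsto (accelRate μ Δ) atTop (𝓝 (2 * μ * Δ)) := by
  have h1 : Tendsto (fun d : ℝ => 2 * μ * Δ + d⁻¹) atTop (𝓝 (2 * μ * Δ)) := by
    simpa using tendsto_inv_atTop_zero.const_add (2 * μ * Δ)
  refine tendsto_of_tendsto_of_tendsto_of_le_of_le' tendsto_const_nhds h1 ?_ ?_
  · filter_upwards [eventually_ge_atTop 1] with d hd using (accelRate_mem ha0 ha1 hd).1.le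
  · filter_upwards [eventually_ge_atTop 1] with d hd
    have hm := accelRate_mem ha0 ha1 hd
    have hd0 : 0 < d := by linarith
    have hle : d * (accelRate μ Δ d - 2 * μ * Δ) ≤ 1 := by
      rw [accelRate_quadratic ha0 hd]
      nlinarith [hm.1, hm.2]
    have := (le_div_iff₀' hd0).2 hle
    rw [one_div] at this
    linarith

/-- The recursion preserves the lower bound `ξ ≥ ξ(δ)`. -/
theorem accelRate_le_of_recursion (ha0 : 0 < 2 * μ * Δ) (ha1 : 2 * μ * Δ < 1) (hδ : 1 ≤ δ)
    {s r : ℝ} (hs : s ∈ Ico (2 * μ * Δ) 1) (hrec : s * (s - 2 * μ * Δ) / (1 - s) = r ^ 2 / δ)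
    (hr : accelRate μ Δ δ ≤ r) : accelRate μ Δ δ ≤ s := by
  have hq := accelRate_quadratic ha0 hδ
  have hm := accelRate_mem ha0 ha1 hδ
  set q := accelRate μ Δ δ
  -- The left side of the recursion increases in `s`. If `s < q`, then `q² (1 - s) ≤ δ s (s - 2μΔ) <
  -- δ q (q - 2μΔ) = q² (1 - q)`, a contradiction.
  by_contra! hlt
  have hs1 : 0 < 1 - s := sub_pos.2 hs.2
  have hδ0 : 0 < δ := by linarith
  rw [div_eq_div_iff hs1.ne' hδ0.ne'] at hrec
  have h1 : q ^ 2 ≤ r ^ 2 := pow_le_pow_left₀ (by linarith [hm.1]) hr 2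
  have h2 : q ^ 2 * (1 - s) ≤ s * (s - 2 * μ * Δ) * δ := by
    rw [hrec]; exact mul_le_mul_of_nonneg_right h1 hs1.le
  have h3 : s * (s - 2 * μ * Δ) < q * (q - 2 * μ * Δ) := by
    nlinarith [hs.1, hm.1]
  have h4 : s * (s - 2 * μ * Δ) * δ < q ^ 2 * (1 - q) := by
    calc s * (s - 2 * μ * Δ) * δ < q * (q - 2 * μ * Δ) * δ := mul_lt_mul_of_pos_right h3 hδ0
      _ = q * (δ * (q - 2 * μ * Δ)) := by ring
      _ = q ^ 2 * (1 - q) := by rw [hq]; ring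
  nlinarith [sq_nonneg q]

end Rate

/-! ### One step in a tangent space -/

section PotentialDecrease

variable {H : Type*} [NormedAddCommGroup H] [InnerProductSpace ℝ H]

/-- One step of the iteration decreases the potential, in terms of the tangent vectors
`g = ∇f(x)`, `p = Exp_x⁻¹(y)`, `q = Exp_x⁻¹(z)` and `w = Exp_x⁻¹(x_*)`. -/
theorem potential_decrease {μ Δ s fx fy fy' fs : ℝ} {g p q w : H} (hΔ : 0 < Δ)
    (ha0 : 0 < 2 * μ * Δ) (hs : s ∈ Ico (2 * μ * Δ) 1)
    (hcol : (1 - s) • p + (s - 2 * μ * Δ) • q = 0)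
    (hstep : fy' ≤ fx - Δ * ‖g‖ ^ 2)
    (hstar : fx + inner ℝ g w + μ / 2 * ‖w‖ ^ 2 ≤ fs)
    (hy : fx + inner ℝ g p ≤ fy) :
    fy' - fs + s ^ 2 / (4 * Δ) * ‖(1 - 2 * μ * Δ / s) • q - (2 * Δ / s) • g - w‖ ^ 2 ≤
      (1 - s) * (fy - fs) + s * (s - 2 * μ * Δ) / (4 * Δ) * ‖q - w‖ ^ 2 := by
  have hs0 : 0 < s := ha0.trans_le hs.1
  have hcol' : (1 - s) * inner ℝ g p + (s - 2 * μ * Δ) * inner ℝ g q = 0 := by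
    have := congrArg (inner ℝ g) hcol
    simpa [inner_add_right, inner_smul_right] using this
  have h1 := mul_le_mul_of_nonneg_left hstar hs0.le
  have h2 := mul_le_mul_of_nonneg_left hy (sub_nonneg.2 hs.2.le)
  -- With `β = 1 - 2μΔ/s`, `β q - w` is the convex combination of `q - w` and `-w`; this is the
  -- variance term in its squared norm, which is discarded.
  have hqq : 0 ≤ (1 - 2 * μ * Δ / s) * (2 * μ * Δ / s) * (s ^ 2 / (4 * Δ)) * ‖q‖ ^ 2 := by
    have : 2 * μ * Δ / s ≤ 1 := (div_le_one hs0).2 hs.1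
    have : 0 ≤ 1 - 2 * μ * Δ / s := by linarith
    positivity
  -- The parameters are tuned to cancel: `Δ ‖g‖²` against the gradient step, the `w` terms against
  -- `s` times strong convexity at the minimizer, and the `q` term, through collinearity, against `1
  -- - s` times convexity at `y`.
  have e1 : s ^ 2 / (4 * Δ) * ‖(1 - 2 * μ * Δ / s) • q - (2 * Δ / s) • g - w‖ ^ 2 =
      s * (s - 2 * μ * Δ) / (4 * Δ) * ‖q - w‖ ^ 2 + s * (μ / 2 * ‖w‖ ^ 2) + Δ * ‖g‖ ^ 2
        - (s - 2 * μ * Δ) * inner ℝ g q + s * inner ℝ g w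
        - (1 - 2 * μ * Δ / s) * (2 * μ * Δ / s) * (s ^ 2 / (4 * Δ)) * ‖q‖ ^ 2 := by
    simp only [← real_inner_self_eq_norm_sq, inner_sub_left, inner_sub_right,
      real_inner_smul_left, real_inner_smul_right]
    rw [real_inner_comm g q, real_inner_comm w q, real_inner_comm g w]
    field_simp
    ring
  linarith

end PotentialDecrease

/-! ### Decay of the potential -/

section Convergence

variable {E : Type*} [NormedAddCommGroup E] [NormedSpace ℝ E] [FiniteDimensional ℝ E]
  {M : Type*} [MetricSpace M] [ChartedSpace E M] [IsManifold 𝓘(ℝ, E) ∞ M]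
  [RiemannianBundle (fun x : M => TangentSpace 𝓘(ℝ, E) x)]
  [IsContMDiffRiemannianBundle 𝓘(ℝ, E) ∞ E (fun x : M => TangentSpace 𝓘(ℝ, E) x)]

/-- A gradient step decreases a geodesically smooth function. -/
theorem GeodesicallySmooth.gradient_step (hM : UniquelyGeodesic E M) {f : M → ℝ} {L γ : ℝ}
    (hf : GeodesicallySmooth E L f) {x y : M} (hy : IsExp x (-(γ • riemGrad E f x)) y) :
    f y ≤ f x - stepGain L γ * ‖riemGrad E f x‖ ^ 2 := by
  have h := hf.2 x y
  rw [← hM.norm_riemLog (E := E) x y, hy.riemLog_eq hM, norm_neg, norm_smul, inner_neg_right,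
    real_inner_smul_right, real_inner_self_eq_norm_sq, mul_pow, Real.norm_eq_abs, sq_abs] at h
  unfold stepGain
  linarith

theorem nesterov_potential_step (hM : UniquelyGeodesic E M) {f : M → ℝ} {L μ γ δ : ℝ}
    (hμ : 0 < μ) (hΔ : 0 < stepGain L γ) (hδ : 1 ≤ δ) (hsmooth : GeodesicallySmooth E L f)
    (hconvex : GeodesicallyStronglyConvex E μ f) (p : M) {x y z : ℕ → M} {ξ : ℕ → ℝ}
    (hiter : IsRiemannianNesterov E f L μ γ δ x y z ξ) {t : ℕ}
    (hvalid : IsValidDistortionRate E p x z δ (t + 1)) :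
    f (y (t + 1)) - f p + ξ (t + 1) ^ 2 / (4 * stepGain L γ) *
        projDist E (x (t + 1)) (z (t + 1)) p ^ 2 ≤
      (1 - ξ (t + 1)) * (f (y t) - f p +
        ξ t ^ 2 / (4 * stepGain L γ) * projDist E (x t) (z t) p ^ 2) := by
  have hs := hiter.ξ_mem t
  have hrec := hiter.ξ_succ t
  have hα := hiter.x_succ t
  have hz := (hiter.z_succ t).riemLog_eq hM
  have hstep := hsmooth.gradient_step hM (hiter.y_succ t)
  have hδ0 : 0 < δ := by linarith
  unfold IsValidDistortionRate at hvalid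
  rw [Nat.add_sub_cancel] at hvalid
  set Δ := stepGain L γ
  set s := ξ (t + 1)
  have ha0 : 0 < 2 * μ * Δ := by positivity
  have hs1 : 0 < 1 - s := sub_pos.2 hs.2
  have ha1 : 0 < 1 - 2 * μ * Δ := by linarith [hs.1]
  -- Here `α = (s - 2μΔ) / (1 - 2μΔ)` and `1 - α = (1 - s) / (1 - 2μΔ)`; the common denominator is
  -- cleared.
  have hcol : (1 - s) • riemLog E (x (t + 1)) (y t) +
      (s - 2 * μ * Δ) • riemLog E (x (t + 1)) (z t) = 0 := by
    have h := hM.riemLog_intermediate (α := (s - 2 * μ * Δ) / (1 - 2 * μ * Δ))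
      ⟨div_nonneg (sub_nonneg.2 hs.1) ha1.le, (div_le_one ha1).2 (by linarith)⟩ hα
    have h2 := congrArg ((1 - 2 * μ * Δ) • ·) h
    simp only [smul_add, smul_smul, smul_zero, mul_sub, mul_one, mul_div_cancel₀ _ ha1.ne'] at h2
    rw [← h2]
    congr 2
    field_simp
    ring
  have hstar := hconvex.2 (x (t + 1)) p
  rw [← hM.norm_riemLog (E := E)] at hstar
  have hy : f (x (t + 1)) + inner ℝ (riemGrad E f (x (t + 1))) (riemLog E (x (t + 1)) (y t)) ≤
      f (y t) := by
    have := hconvex.2 (x (t + 1)) (y t)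
    have : 0 ≤ μ / 2 * dist (x (t + 1)) (y t) ^ 2 := by positivity
    linarith
  have key := potential_decrease hΔ ha0 hs hcol hstep hstar hy
  rw [← hz] at key
  change f (y (t + 1)) - f p + s ^ 2 / (4 * Δ) * projDist E (x (t + 1)) (z (t + 1)) p ^ 2 ≤
    _ + s * (s - 2 * μ * Δ) / (4 * Δ) * projDist E (x (t + 1)) (z t) p ^ 2 at key
  refine key.trans ?_
  rw [div_eq_div_iff hs1.ne' hδ0.ne'] at hrec
  -- The recursion puts `1 / δ` into the coefficient, exactly offsetting the distortion from moving
  -- the base point.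
  have e : s * (s - 2 * μ * Δ) / (4 * Δ) = (1 - s) * (ξ t ^ 2 / (4 * Δ)) / δ := by
    rw [eq_div_iff hδ0.ne', div_mul_eq_mul_div, hrec]
    ring
  have hle : s * (s - 2 * μ * Δ) / (4 * Δ) * projDist E (x (t + 1)) (z t) p ^ 2 ≤
      (1 - s) * (ξ t ^ 2 / (4 * Δ)) * projDist E (x t) (z t) p ^ 2 := by
    calc _ ≤ s * (s - 2 * μ * Δ) / (4 * Δ) * (δ * projDist E (x t) (z t) p ^ 2) := by
          apply mul_le_mul_of_nonneg_left hvalid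
          rw [e]
          positivity
      _ = _ := by rw [e]; field_simp
  linarith

/-- The bound on `ξ t` is carried along in the induction so that `1 - ξ (t+1)` can be replaced by
the constant factor. This needs a nonnegative potential, hence the minimality of `p`. -/
theorem nesterov_potential_le (hM : UniquelyGeodesic E M) {f : M → ℝ} {L μ γ δ : ℝ}
    (hμ : 0 < μ) (hΔ : 0 < stepGain L γ) (hδ : 1 ≤ δ) (hsmooth : GeodesicallySmooth E L f)
    (hconvex : GeodesicallyStronglyConvex E μ f) {p : M} (hp : ∀ q, f p ≤ f q) {x y z : ℕ → M}
    {ξ : ℕ → ℝ} (hiter : IsRiemannianNesterov E f L μ γ δ x y z ξ)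
    (hvalid : ∀ t, 1 ≤ t → IsValidDistortionRate E p x z δ t)
    (hξ : accelRate μ (stepGain L γ) δ ≤ ξ 0) (t : ℕ) :
    accelRate μ (stepGain L γ) δ ≤ ξ t ∧
    f (y t) - f p + ξ t ^ 2 / (4 * stepGain L γ) * projDist E (x t) (z t) p ^ 2 ≤
      (1 - accelRate μ (stepGain L γ) δ) ^ t * (f (y 0) - f p +
        ξ 0 ^ 2 / (4 * stepGain L γ) * projDist E (x 0) (z 0) p ^ 2) := by
  have ha0 : 0 < 2 * μ * stepGain L γ := by positivity
  have ha1 : 2 * μ * stepGain L γ < 1 := (hiter.ξ_mem 0).1.trans_lt (hiter.ξ_mem 0).2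
  have hm := accelRate_mem ha0 ha1 hδ
  induction t with
  | zero => simpa using hξ
  | succ t ih =>
    have hle := accelRate_le_of_recursion ha0 ha1 hδ (hiter.ξ_mem t) (hiter.ξ_succ t) ih.1
    refine ⟨hle, ?_⟩
    have hpot : 0 ≤ f (y t) - f p +
        ξ t ^ 2 / (4 * stepGain L γ) * projDist E (x t) (z t) p ^ 2 :=
      add_nonneg (sub_nonneg.2 (hp _)) (by positivity)
    calc _ ≤ _ := nesterov_potential_step hM hμ hΔ hδ hsmooth hconvex p hiter
          (hvalid (t + 1) (by omega))
      _ ≤ (1 - accelRate μ (stepGain L γ) δ) * _ :=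
          mul_le_mul_of_nonneg_right (by linarith) hpot
      _ ≤ (1 - accelRate μ (stepGain L γ) δ) * _ :=
          mul_le_mul_of_nonneg_left ih.2 (by linarith [hm.2])
      _ = _ := by ring

end Convergence

theorem corollary2
    {E : Type*} [NormedAddCommGroup E] [NormedSpace ℝ E] [FiniteDimensional ℝ E]
    {M : Type*} [MetricSpace M] [ChartedSpace E M] [IsManifold 𝓘(ℝ, E) ∞ M]
    [RiemannianBundle (fun x : M => TangentSpace 𝓘(ℝ, E) x)]
    [IsContMDiffRiemannianBundle 𝓘(ℝ, E) ∞ E (fun x : M => TangentSpace 𝓘(ℝ, E) x)]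
    [IsRiemannianManifold 𝓘(ℝ, E) M]
    (hM : UniquelyGeodesic E M)
    (f : M → ℝ) (L μ γ δ : ℝ) (hL : 0 < L) (hμ : 0 < μ) (hγ : γ ∈ Ioo 0 (2 / L)) (hδ : 1 ≤ δ)
    (hsmooth : GeodesicallySmooth E L f) (hconvex : GeodesicallyStronglyConvex E μ f)
    (xstar : M) (hxstar : ∀ x, f xstar ≤ f x)
    (x y z : ℕ → M) (ξ : ℕ → ℝ)
    (hiter : IsRiemannianNesterov E f L μ γ δ x y z ξ)
    (hvalid : ∀ t, 1 ≤ t → IsValidDistortionRate E xstar x z δ t)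
    (hξ : accelRate μ (stepGain L γ) δ ≤ ξ 0) :
    -- the convergence rate, with its implied constant
    (∀ t, f (y t) - f xstar ≤
      (∏ _i ∈ Finset.Icc 1 t, (1 - accelRate μ (stepGain L γ) δ)) *
        (f (y 0) - f xstar
          + ξ 0 ^ 2 / (4 * stepGain L γ) * projDist E (x 0) (z 0) xstar ^ 2)) ∧
    ((fun t => f (y t) - f xstar) =O[atTop]
      fun t : ℕ => ∏ _i ∈ Finset.Icc 1 t, (1 - accelRate μ (stepGain L γ) δ)) ∧
    ((fun t => f (y t) - f xstar) =O[atTop]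
      fun t : ℕ => Real.exp (-(t * accelRate μ (stepGain L γ) δ))) ∧
    -- the step size `γ = 1 / L`
    (γ = 1 / L → (fun t => f (y t) - f xstar) =O[atTop]
      fun t : ℕ => Real.exp (-((t : ℝ) / 2 * (√((δ - 1) ^ 2 + 4 * δ * (μ / L)) - (δ - 1))))) ∧
    -- `ξ(·)` is strictly decreasing, from `√(2 μ Δ_γ)` at `1` to the limit `2 μ Δ_γ`,
    -- and stays strictly above the limit
    StrictAntiOn (accelRate μ (stepGain L γ)) (Ici 1) ∧
    accelRate μ (stepGain L γ) 1 = √(2 * μ * stepGain L γ) ∧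
    (∀ d, 1 ≤ d → 2 * μ * stepGain L γ < accelRate μ (stepGain L γ) d) ∧
    Tendsto (accelRate μ (stepGain L γ)) atTop (𝓝 (2 * μ * stepGain L γ)) := by
  have hγL : γ * L < 2 := (lt_div_iff₀ hL).1 hγ.2
  have hΔ : 0 < stepGain L γ := mul_pos hγ.1 (by linarith)
  have ha0 : 0 < 2 * μ * stepGain L γ := by positivity
  -- This follows from the interval containing `ξ 1` being nonempty, without comparing `μ` and `L`.
  have ha1 : 2 * μ * stepGain L γ < 1 := (hiter.ξ_mem 0).1.trans_lt (hiter.ξ_mem 0).2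
  have hm := accelRate_mem ha0 ha1 hδ
  have hbound : ∀ t, f (y t) - f xstar ≤ (1 - accelRate μ (stepGain L γ) δ) ^ t *
      (f (y 0) - f xstar
        + ξ 0 ^ 2 / (4 * stepGain L γ) * projDist E (x 0) (z 0) xstar ^ 2) := fun t =>
    (le_add_of_nonneg_right (by positivity)).trans
      (nesterov_potential_le hM hμ hΔ hδ hsmooth hconvex hxstar hiter hvalid hξ t).2
  have hpow : (fun t => f (y t) - f xstar) =O[atTop]
      fun t : ℕ => (1 - accelRate μ (stepGain L γ) δ) ^ t := by
    refine IsBigO.of_bound (f (y 0) - f xstar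
      + ξ 0 ^ 2 / (4 * stepGain L γ) * projDist E (x 0) (z 0) xstar ^ 2)
      (Eventually.of_forall fun t => ?_)
    rw [Real.norm_of_nonneg (sub_nonneg.2 (hxstar _)),
      Real.norm_of_nonneg (pow_nonneg (by linarith [hm.2]) t), mul_comm]
    exact hbound t
  have hexp : (fun t => f (y t) - f xstar) =O[atTop]
      fun t : ℕ => Real.exp (-(t * accelRate μ (stepGain L γ) δ)) := by
    refine hpow.trans (IsBigO.of_bound 1 (Eventually.of_forall fun t => ?_))
    rw [Real.norm_of_nonneg (pow_nonneg (by linarith [hm.2]) t),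
      Real.norm_of_nonneg (Real.exp_pos _).le, one_mul, ← mul_neg, Real.exp_nat_mul]
    exact pow_le_pow_left₀ (by linarith [hm.2]) (Real.one_sub_le_exp_neg _) t
  refine ⟨fun t => by simpa using hbound t, by simpa using hpow, hexp, fun h => ?_,
    strictAntiOn_accelRate ha0 ha1, accelRate_one, fun d hd => (accelRate_mem ha0 ha1 hd).1,
    tendsto_accelRate ha0 ha1⟩
  -- For `γ = 1 / L` the gain is `1 / (2L)`.
  have he : 8 * δ * μ * stepGain L γ = 4 * δ * (μ / L) := by
    rw [h, stepGain]
    field_simp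
    ring
  convert hexp using 4 with t
  rw [accelRate, he]
  ring
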